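/- Let $\mathbb F$ be a finite field and let $n$ be a positive integer coprime to $|\mathbb F|$. Let $A=\mathbb F[x]/\langle x^n-1\rangle$, and let $x^n-1=\pi_1\cdots\pi_r$ with $\pi_1,\dots,\pi_r\in\mathbb F[x]$ monic, irreducible and pairwise different. Let $\varepsilon_1,\dots,\varepsilon_r\in A$ be the corresponding primitive idempotents, i.e. $\varepsilon_k\equiv\delta_{kj} \bmod \pi_j$ for all $j$. Let $\sigma$ be an $\mathbb F$-algebra automorphism of $A$. For indices $k,l\in\{1,\dots,r\}$ write $k\equiv_\sigma l$ if $\sigma^i(\varepsilon_k)=\varepsilon_l$ for some $i\ge 0$ (that is, $k$ and $l$ lie in the same cycle of the permutation $\Pi_\sigma$ defined by $\sigma(\varepsilon_k)=\varepsilon_{\Pi_\sigma(k)}$), and let $o_l(\sigma)=\min\{m\ge 1\mid \sigma^m(\varepsilon_l)=\varepsilon_l\}$. Let $A[z;\sigma]$ be the skew polynomial ring of all polynomials $\sum_j z^ja_j$ with $a_j\in A$, with multiplication given by $az=z\sigma(a)$ for $a\in A$. Let $\mathfrak p:\mathbb F[z]^n\to A[z;\sigma]$ be the bijection $\sum_j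 z^jv_j\mapsto\sum_j z^j\mathfrak p(v_j)$, where $\mathfrak p(c_0,\dots,c_{n-1})=\sum_i c_ix^i$ for $(c_0,\dots,c_{n-1})\in\mathbb F^n$. We use the following notions. * A *$\sigma$-cyclic code* is a direct summand $\mathcal C$ of the $\mathbb F[z]$-module $\mathbb F[z]^n$ such that $\mathfrak p(\mathcal C)$ is a left ideal of $A[z;\sigma]$. * A code $\mathcal C$ has *parameters* $(n,k,\delta)$ if $\mathcal C=\{uG\mid u\in\mathbb F[z]^k\}$ for some right invertible matrix $G\in\mathbb F[z]^{k\times n}$ whose $k\times k$ minors have maximal degree $\delta$; then $k$ is the rank and $\delta$ the complexity of $\mathcal C$. * For $f\in A[z;\sigma]$ put $f^{(k)}=\varepsilon_kf$ and $T_f=\{k\mid f^{(k)}\neq0\}$. The *terms* of $f=\sum_\nu z^\nu f_\nu$ are the $z^\nu\varepsilon_lf_\nu$. If $f\ne0$, its *leading monomial* is the largest $z^\nu\varepsilon_l$ with $\varepsilon_lf_\nu\neq0$, where $z^\mu\varepsilon_k<z^\nu\varepsilon_l$ means $\mu<\nu$, or $\mu=\nu$ and $k<l$. The polynomial $f$ is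 *reduced* if for all $k\ne l$ with $f^{(l)}\neq 0$ no nonzero term of $f^{(k)}$ is right divisible by the leading monomial of $f^{(l)}$. * A $\sigma$-cyclic code $\mathcal C$ has *support* $T\subseteq\{1,\dots,r\}$ if $\mathfrak p(\mathcal C)$ is the left ideal $\{fg\mid f\in A[z;\sigma]\}$ generated by some reduced polynomial $g$ with $T_g=T$. **Statement.** Let $l_1,\dots,l_t\in\{1,\dots,r\}$ be such that $l_i\not\equiv_\sigma l_j$ for $i\neq j$ and $o_{l_i}(\sigma)>1$ for all $i=1,\dots,t$. Put $k_i=\deg\pi_{l_i}$. Then for all integers $d_1,\dots,d_t\ge0$ there exists a $\sigma$-cyclic code $\mathcal C\subseteq\mathbb F[z]^n$ with parameters $\bigl(n,\ \sum_{i=1}^tk_i,\ \sum_{i=1}^tk_id_i\bigr)$ and support $\{l_1,\dots,l_t\}$. -/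

import Mathlib

open Polynomial

noncomputable section

namespace CyclicConv

/-! ### The Piret algebra `A[z;σ]` -/

section Piret

variable {F A : Type*} [CommSemiring F] [CommRing A] [Algebra F A]

/-- The action of `ℕ` on `A` by powers of `σ`. -/
abbrev powAction (σ : A ≃ₐ[F] A) : MulSemiringAction (Multiplicative ℕ) A :=
  MulSemiringAction.compHom A (powersHom (A ≃ₐ[F] A) σ)

/-- The skew polynomial ring `A[z;σ]` with right coefficients and `a z = z σ(a)`.
Mathlib's `SkewPolynomial A` has left coefficients and `X a = σ(a) X`; since `A` is commutative,
its opposite ring is `A[z;σ]`, with `∑ a_j X^j` read as `∑ z^j a_j` (see `coeff_mul` below). -/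
def PiretAlgebra (_σ : A ≃ₐ[F] A) : Type _ := (SkewPolynomial A)ᵐᵒᵖ

instance (σ : A ≃ₐ[F] A) : Ring (PiretAlgebra σ) :=
  letI := powAction σ
  inferInstanceAs (Ring (SkewPolynomial A)ᵐᵒᵖ)

namespace PiretAlgebra

variable {σ : A ≃ₐ[F] A}

/-- The element `z^j a`. -/
def zpowMul (σ : A ≃ₐ[F] A) (j : ℕ) (a : A) : PiretAlgebra σ :=
  MulOpposite.op (SkewPolynomial.monomial j a)

/-- The inclusion of `A` as the ring of constants. -/
def const (σ : A ≃ₐ[F] A) (a : A) : PiretAlgebra σ := zpowMul σ 0 a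

/-- The right coefficient `f_j` of `f = ∑ z^j f_j`. -/
def coeff (f : PiretAlgebra σ) (j : ℕ) : A :=
  SkewPolynomial.coeff (MulOpposite.unop f) j

@[ext] theorem ext {f g : PiretAlgebra σ} (h : ∀ j, f.coeff j = g.coeff j) : f = g :=
  MulOpposite.unop_injective (SkewMonoidAlgebra.ext fun j => h (Multiplicative.toAdd j))

theorem coeff_zpowMul (i j : ℕ) (a : A) :
    (zpowMul σ i a).coeff j = if i = j then a else 0 := by
  classical
  exact (SkewMonoidAlgebra.coeff_single_apply (a := Multiplicative.ofAdd i)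
    (a' := Multiplicative.ofAdd j) (b := a)).trans (by simp)

theorem coeff_zero (j : ℕ) : (0 : PiretAlgebra σ).coeff j = 0 := rfl

theorem coeff_add (f g : PiretAlgebra σ) (j : ℕ) :
    (f + g).coeff j = f.coeff j + g.coeff j := by
  change SkewMonoidAlgebra.coeff (MulOpposite.unop f + MulOpposite.unop g) _ = _
  rw [SkewMonoidAlgebra.coeff_add]
  rfl

theorem coeff_sum {ι : Type*} (s : Finset ι) (f : ι → PiretAlgebra σ) (j : ℕ) :
    (∑ i ∈ s, f i).coeff j = ∑ i ∈ s, (f i).coeff j :=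
  map_sum (⟨⟨fun f : PiretAlgebra σ => f.coeff j, coeff_zero j⟩,
    fun f g => coeff_add f g j⟩ : PiretAlgebra σ →+ A) f s

/-- The defining multiplication rule
`(∑ z^j a_j) (∑ z^l b_l) = ∑_t z^t ∑_{j+l=t} σ^l(a_j) b_l`. -/
theorem coeff_mul (f g : PiretAlgebra σ) (t : ℕ) :
    (f * g).coeff t =
      ∑ p ∈ Finset.HasAntidiagonal.antidiagonal t, (σ ^ p.2) (f.coeff p.1) * g.coeff p.2 := by
  let _ := powAction σ
  have h := SkewMonoidAlgebra.coeff_mul_antidiagonal_of_finset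
    (MulOpposite.unop g : SkewPolynomial A) (MulOpposite.unop f : SkewPolynomial A)
    (Multiplicative.ofAdd t)
    ((Finset.HasAntidiagonal.antidiagonal t).map
      ((Equiv.prodComm ℕ ℕ).trans
        (Equiv.prodCongr Multiplicative.ofAdd Multiplicative.ofAdd)).toEmbedding)
    (by
      rintro ⟨a, b⟩
      rw [Finset.mem_map_equiv, Finset.HasAntidiagonal.mem_antidiagonal]
      change Multiplicative.toAdd b + Multiplicative.toAdd a = t ↔
        Multiplicative.toAdd a + Multiplicative.toAdd b = t
      rw [add_comm])
  rw [Finset.sum_map] at h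
  exact h.trans (Finset.sum_congr rfl fun p _ => mul_comm _ _)

end PiretAlgebra

end Piret

/-! ### The ring `A = F[x]/(x^n - 1)` and its primitive idempotents -/

section Idempotents

variable {F : Type*} [Field F] {n r : ℕ}

/-- `A = F[x]/(x^n - 1)`. -/
abbrev CyclicRing (F : Type*) [Field F] (n : ℕ) : Type _ := AdjoinRoot (X ^ n - 1 : F[X])

/-- `x^n - 1 = π_1 ⋯ π_r` with monic, irreducible, pairwise different `π_k`. -/
structure IsPrimeFactorization (n : ℕ) (π : Fin r → F[X]) : Prop where
  monic : ∀ k, (π k).Monic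
  irreducible : ∀ k, Irreducible (π k)
  injective : Function.Injective π
  prod_eq : ∏ k, π k = X ^ n - 1

variable {π : Fin r → F[X]}

theorem IsPrimeFactorization.dvd (hπ : IsPrimeFactorization n π) (k : Fin r) :
    π k ∣ X ^ n - 1 :=
  hπ.prod_eq ▸ Finset.dvd_prod_of_mem π (Finset.mem_univ k)

theorem IsPrimeFactorization.isCoprime (hπ : IsPrimeFactorization n π) {j k : Fin r}
    (h : j ≠ k) : IsCoprime (π j) (π k) := by
  refine (hπ.irreducible j).coprime_iff_not_dvd.2 fun hd => h (hπ.injective ?_)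
  exact eq_of_monic_of_associated (hπ.monic j) (hπ.monic k)
    ((hπ.irreducible j).associated_of_dvd (hπ.irreducible k) hd)

/-- The canonical projection `ρ_k : A → K_k = F[x]/(π_k)`. -/
def proj (hπ : IsPrimeFactorization n π) (k : Fin r) :
    CyclicRing F n →ₐ[F] AdjoinRoot (π k) :=
  AdjoinRoot.algHomOfDvd F _ _ (hπ.dvd k)

theorem proj_mk (hπ : IsPrimeFactorization n π) (k : Fin r) (p : F[X]) :
    proj hπ k (AdjoinRoot.mk _ p) = AdjoinRoot.mk (π k) p := by
  rw [← AdjoinRoot.aeval_eq, ← AdjoinRoot.aeval_eq, ← aeval_algHom_apply, proj,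
    AdjoinRoot.algHomOfDvd_root]

theorem proj_bijective (hπ : IsPrimeFactorization n π) :
    Function.Bijective
      (RingHom.pi fun k => (proj hπ k : CyclicRing F n →+* AdjoinRoot (π k))) := by
  constructor
  · rw [injective_iff_map_eq_zero]
    intro a ha
    obtain ⟨p, rfl⟩ := AdjoinRoot.mk_surjective a
    rw [AdjoinRoot.mk_eq_zero, ← hπ.prod_eq]
    refine Fintype.prod_dvd_of_coprime (fun i j h => hπ.isCoprime h) fun k => ?_
    rw [← AdjoinRoot.mk_eq_zero, ← proj_mk hπ]
    exact congrFun ha k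
  · intro b
    choose q hq using fun k => AdjoinRoot.mk_surjective (b k)
    obtain ⟨p, hp⟩ := Ideal.exists_forall_sub_mem_ideal
      (I := fun k => Ideal.span {π k})
      (fun i j h => (Ideal.isCoprime_span_singleton_iff _ _).2 (hπ.isCoprime h)) q
    refine ⟨AdjoinRoot.mk _ p, funext fun k => ?_⟩
    change proj hπ k (AdjoinRoot.mk _ p) = b k
    rw [proj_mk, ← hq k, AdjoinRoot.mk_eq_mk]
    exact Ideal.mem_span_singleton.1 (hp k)

/-- The Chinese remainder isomorphism `ψ : A → K_1 × ⋯ × K_r`. -/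
def crt (hπ : IsPrimeFactorization n π) : CyclicRing F n ≃+* ∀ k, AdjoinRoot (π k) :=
  RingEquiv.ofBijective _ (proj_bijective hπ)

/-- The primitive idempotent `ε_k` of `A`. -/
def idem (hπ : IsPrimeFactorization n π) (k : Fin r) : CyclicRing F n :=
  (crt hπ).symm (Pi.single k 1)

/-- `k ≡_σ l`: the indices `k` and `l` lie in the same cycle of the permutation `Π_σ`
given by `σ(ε_k) = ε_{Π_σ(k)}`. -/
def SigmaEquiv (hπ : IsPrimeFactorization n π) (σ : CyclicRing F n ≃ₐ[F] CyclicRing F n)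
    (k l : Fin r) : Prop :=
  ∃ i : ℕ, (σ ^ i) (idem hπ k) = idem hπ l

/-- The `l`-order `o_l(σ)`, the least `m ≥ 1` with `σ^m(ε_l) = ε_l`. -/
def lOrder (hπ : IsPrimeFactorization n π) (σ : CyclicRing F n ≃ₐ[F] CyclicRing F n)
    (l : Fin r) : ℕ :=
  Function.minimalPeriod σ (idem hπ l)

end Idempotents

/-! ### Components, support and reducedness in `A[z;σ]` -/

section Reduced

variable {F : Type*} [Field F] {n r : ℕ} {π : Fin r → F[X]}
  {σ : CyclicRing F n ≃ₐ[F] CyclicRing F n}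

/-- The `k`-th component `f^(k) = ε_k f`. -/
def component (hπ : IsPrimeFactorization n π) (f : PiretAlgebra σ) (k : Fin r) :
    PiretAlgebra σ :=
  PiretAlgebra.const σ (idem hπ k) * f

/-- The support `T_f = {k | f^(k) ≠ 0}`. -/
def supp (hπ : IsPrimeFactorization n π) (f : PiretAlgebra σ) : Set (Fin r) :=
  {k | component hπ f k ≠ 0}

/-- The term `z^ν ε_l f_ν` of `f`. -/
def term (hπ : IsPrimeFactorization n π) (f : PiretAlgebra σ) (ν : ℕ) (l : Fin r) :
    PiretAlgebra σ :=
  PiretAlgebra.zpowMul σ ν (idem hπ l * f.coeff ν)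

/-- `z^μ ε_k` is the leading monomial of `f` (where `f ≠ 0`). Monomials are compared
by `z^μ ε_k < z^ν ε_l` iff `μ < ν`, or `μ = ν` and `k < l`. -/
def IsLeadingMonomial (hπ : IsPrimeFactorization n π) (f : PiretAlgebra σ)
    (μ : ℕ) (k : Fin r) : Prop :=
  IsGreatest {m : ℕ ×ₗ Fin r | term hπ f (ofLex m).1 (ofLex m).2 ≠ 0} (toLex (μ, k))

/-- `f` is (left) reduced: for `k ≠ l` no nonzero term of `f^(k)` is right divisible by the
leading monomial of `f^(l)`. -/
def IsReduced (hπ : IsPrimeFactorization n π) (f : PiretAlgebra σ) : Prop :=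
  ∀ k l : Fin r, k ≠ l → ∀ (μ : ℕ) (m : Fin r), IsLeadingMonomial hπ (component hπ f l) μ m →
    ∀ (ν : ℕ) (j : Fin r), term hπ (component hπ f k) ν j ≠ 0 →
      ¬ ∃ h : PiretAlgebra σ,
        term hπ (component hπ f k) ν j = h * PiretAlgebra.zpowMul σ μ (idem hπ m)

end Reduced

/-! ### Convolutional codes and `σ`-cyclic codes -/

section Codes

variable {F : Type*} [Field F] {n r : ℕ}

/-- The complexity of `G`, the largest degree of its `k`-minors. -/
def complexity {k : ℕ} (G : Matrix (Fin k) (Fin n) F[X]) : ℕ :=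
  Finset.univ.sup fun f : Fin k ↪o Fin n => (G.submatrix id f).det.natDegree

/-- `C` is a convolutional code with parameters `(n, k, δ)`: `C = im G = {u G}` for a right
invertible matrix `G ∈ F[z]^{k × n}` of complexity `δ`. -/
def HasParameters (C : Submodule F[X] (Fin n → F[X])) (k δ : ℕ) : Prop :=
  ∃ G : Matrix (Fin k) (Fin n) F[X],
    LinearMap.range G.vecMulLinear = C ∧
    (∃ G' : Matrix (Fin n) (Fin k) F[X], G * G' = 1) ∧
    complexity G = δ

/-- `F^n → A`, `(v_0, …, v_{n-1}) ↦ ∑ v_i x^i`. -/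
def toCyclicRing (v : Fin n → F) : CyclicRing F n :=
  ∑ i, v i • AdjoinRoot.root (X ^ n - 1 : F[X]) ^ (i : ℕ)

/-- The map `𝔭 : F[z]^n → A[z;σ]`, `∑ z^j v_j ↦ ∑ z^j 𝔭(v_j)` with `v_j ∈ F^n`. -/
def toPiret (σ : CyclicRing F n ≃ₐ[F] CyclicRing F n) (v : Fin n → F[X]) : PiretAlgebra σ :=
  ∑ j ∈ Finset.univ.biUnion fun i => (v i).support,
    PiretAlgebra.zpowMul σ j (toCyclicRing fun i => (v i).coeff j)

theorem coeff_toPiret (σ : CyclicRing F n ≃ₐ[F] CyclicRing F n) (v : Fin n → F[X]) (j : ℕ) :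
    (toPiret σ v).coeff j = toCyclicRing fun i => (v i).coeff j := by
  simp only [toPiret, PiretAlgebra.coeff_sum, PiretAlgebra.coeff_zpowMul, Finset.sum_ite_eq']
  split_ifs with h
  · rfl
  · simp only [Finset.mem_biUnion, Finset.mem_univ, true_and, mem_support_iff, not_exists,
      not_not] at h
    simp [toCyclicRing, h]

/-- A submodule of `F[z]^n` is `σ`-cyclic if its image under `𝔭` is a left ideal of `A[z;σ]`. -/
def IsSigmaCyclic (σ : CyclicRing F n ≃ₐ[F] CyclicRing F n)
    (S : Submodule F[X] (Fin n → F[X])) : Prop :=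
  ∃ I : Ideal (PiretAlgebra σ), toPiret σ '' S = I

/-- A `σ`-cyclic code is a `σ`-cyclic submodule that is a direct summand of `F[z]^n`. -/
def IsSigmaCyclicCode (σ : CyclicRing F n ≃ₐ[F] CyclicRing F n)
    (C : Submodule F[X] (Fin n → F[X])) : Prop :=
  (∃ D : Submodule F[X] (Fin n → F[X]), IsCompl C D) ∧ IsSigmaCyclic σ C

/-- `C` has support `T`: `𝔭(C)` is the left ideal generated by a reduced polynomial `g` with
`T_g = T`. -/
def HasSupport {π : Fin r → F[X]} (hπ : IsPrimeFactorization n π)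
    (σ : CyclicRing F n ≃ₐ[F] CyclicRing F n)
    (C : Submodule F[X] (Fin n → F[X])) (T : Set (Fin r)) : Prop :=
  ∃ g : PiretAlgebra σ, IsReduced hπ g ∧ supp hπ g = T ∧
    toPiret σ '' C = (Ideal.span {g} : Ideal (PiretAlgebra σ))

end Codes

end CyclicConv

end

open Polynomial

noncomputable section

namespace CyclicConv

/-! ### Minors of row-reduced polynomial matrices -/

section Minors

/-! Write ε_i for the idempotent of index l_i and e = ∑ ε_i. The code is the left ideal generated by
g = e(1 + N₁)(1 + N₂), where N₁ and N₂ square to zero. With v = (1 - N₂)(1 - N₁) this gives e g = g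
and g v = e, so v g is idempotent and generates the same left ideal. That ideal is the image of the
F[z]-linear projection x ↦ x v g, hence a direct summand, and right multiplication by v carries it
to the ideal of e, which is free of rank ∑ k_i.

The nilpotents are chosen so that ε_i g has degree d_i and leading coefficient σ^{d_i}(ε_i)
(`exists_generator`). If σ^{d_i} moves ε_i, a single shift by z^{d_i} squares to zero. If d_i > 0
and σ^{d_i} fixes ε_i, the shift is split into one by z^{d_i - 1} followed by one by z; both square
to zero because σ moves ε_i.

An F-basis of each ε_i A, multiplied by g, gives a generator matrix whose rows have k_i-fold degree
d_i. Idempotents from different cycles are orthogonal, so the leading rows are independent and the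
complexity is the sum of the row degrees (`complexity_eq_sum`). The same orthogonality makes g
reduced (`isReduced_of_not_sigmaEquiv`). -/

theorem natDegree_prod_le_and_coeff_prod {R ι : Type*} [CommSemiring R] (s : Finset ι)
    (f : ι → R[X]) (D : ι → ℕ) (h : ∀ i ∈ s, (f i).natDegree ≤ D i) :
    (∏ i ∈ s, f i).natDegree ≤ ∑ i ∈ s, D i ∧
      (∏ i ∈ s, f i).coeff (∑ i ∈ s, D i) = ∏ i ∈ s, (f i).coeff (D i) := by
  classical
  induction s using Finset.induction_on with
  | empty => simp
  | insert a s ha ih =>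
    obtain ⟨h1, h2⟩ := ih fun i hi => h i (Finset.mem_insert_of_mem hi)
    have h3 := h a (Finset.mem_insert_self a s)
    rw [Finset.prod_insert ha, Finset.sum_insert ha, Finset.prod_insert ha]
    exact ⟨natDegree_mul_le_of_le h3 h1, by rw [coeff_mul_add_eq_of_natDegree_le h3 h1, h2]⟩

/-- Each product in the Leibniz expansion takes one entry from every row, so row-degree bounds add
up and the top coefficients form the expansion of the leading determinant. -/
theorem natDegree_det_le_and_coeff_det {R ι : Type*} [CommRing R] [Fintype ι] [DecidableEq ι]
    (M : Matrix ι ι R[X]) (D : ι → ℕ) (h : ∀ i j, (M i j).natDegree ≤ D i) :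
    M.det.natDegree ≤ ∑ i, D i ∧
      M.det.coeff (∑ i, D i) = (Matrix.of fun i j => (M i j).coeff (D i)).det := by
  -- `Matrix.det_apply` permutes the row index; after transposing, the row index is the product
  -- index, where the bound `D` applies.
  rw [← Matrix.det_transpose M, ← Matrix.det_transpose (Matrix.of _), Matrix.det_apply,
    Matrix.det_apply]
  constructor
  · refine natDegree_sum_le_of_forall_le _ _ fun p _ => ?_
    rw [Units.smul_def, zsmul_eq_mul]
    refine (natDegree_mul_le).trans ?_
    rw [natDegree_intCast, zero_add]
    exact (natDegree_prod_le_and_coeff_prod _ _ D fun i _ => h i _).1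
  · rw [finsetSum_coeff]
    refine Finset.sum_congr rfl fun p _ => ?_
    rw [Units.smul_def, Units.smul_def, coeff_smul]
    congr 1
    exact (natDegree_prod_le_and_coeff_prod _ _ D fun i _ => h i _).2

/-- Row rank equals column rank, so the columns span K^k and contain a basis; the positions of that
basis, in increasing order, select the minor. -/
theorem exists_orderEmbedding_det_ne_zero {K : Type*} [Field K] {k n : ℕ}
    (L : Matrix (Fin k) (Fin n) K) (hL : LinearIndependent K L.row) :
    ∃ f : Fin k ↪o Fin n, (L.submatrix id f).det ≠ 0 := by
  classical
  have hspan : Submodule.span K (Set.range L.col) = ⊤ := by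
    have h := L.rank_eq_finrank_span_cols
    rw [LinearIndependent.rank_matrix hL] at h
    apply Submodule.eq_top_of_finrank_eq
    rw [← h]
    simp
  obtain ⟨s, hs, hspan', hli⟩ := exists_linearIndependent K (Set.range L.col)
  rw [hspan] at hspan'
  choose c hc using fun x : s => hs x.2
  have hcinj : Function.Injective c := fun x y h => Subtype.ext (by rw [← hc, ← hc, h])
  have := Fintype.ofInjective c hcinj
  let B : Module.Basis s K (Fin k → K) := Module.Basis.mk hli (by simp [hspan'])
  have hcard : (Finset.univ.image c).card = k := by
    rw [Finset.card_image_of_injective _ hcinj, Finset.card_univ,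
      ← Module.finrank_eq_card_basis B]
    simp
  refine ⟨(Finset.univ.image c).orderEmbOfFin hcard, ?_⟩
  rw [← Matrix.det_transpose, ← isUnit_iff_ne_zero, ← Matrix.isUnit_iff_isUnit_det,
    ← Matrix.linearIndependent_rows_iff_isUnit]
  have hmem : ∀ i, ∃ x : s, c x = (Finset.univ.image c).orderEmbOfFin hcard i := fun i => by
    obtain ⟨x, -, hx⟩ := Finset.mem_image.1 (Finset.orderEmbOfFin_mem (Finset.univ.image c) hcard i)
    exact ⟨x, hx⟩
  choose g hg using hmem
  have hginj : Function.Injective g := fun i j h => by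
    have : c (g i) = c (g j) := by rw [h]
    rw [hg, hg] at this
    exact (Finset.orderEmbOfFin _ hcard).injective this
  have hrow : (L.submatrix id ((Finset.univ.image c).orderEmbOfFin hcard)).transpose.row =
      (Subtype.val : s → Fin k → K) ∘ g := by
    funext i
    change L.col _ = (g i : Fin k → K)
    rw [← hg, hc]
  rw [hrow]
  exact hli.comp g hginj

/-- Row reducedness: some maximal minor of the leading matrix is nonzero, so the degree bound is
attained there. -/
theorem complexity_eq_sum {F : Type*} [Field F] {k n : ℕ} (G : Matrix (Fin k) (Fin n) F[X])
    (D : Fin k → ℕ) (h : ∀ i j, (G i j).natDegree ≤ D i)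
    (hlead : LinearIndependent F fun i => fun j => (G i j).coeff (D i)) :
    complexity G = ∑ i, D i := by
  apply le_antisymm
  · exact Finset.sup_le fun f _ =>
      (natDegree_det_le_and_coeff_det (G.submatrix id f) D fun i j => h i _).1
  · obtain ⟨f, hf⟩ := exists_orderEmbedding_det_ne_zero
      (Matrix.of fun i j => (G i j).coeff (D i)) hlead
    refine le_trans ?_ (Finset.le_sup (f := fun f : Fin k ↪o Fin n =>
      (G.submatrix id f).det.natDegree) (Finset.mem_univ f))
    apply le_natDegree_of_ne_zero
    rw [(natDegree_det_le_and_coeff_det (G.submatrix id f) D fun i j => h i _).2]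
    exact hf

end Minors

/-! ### Arithmetic of `A[z;σ]` -/

namespace PiretAlgebra

variable {F A : Type*} [CommSemiring F] [CommRing A] [Algebra F A] {σ : A ≃ₐ[F] A}

theorem zpowMul_mul_coeff (i : ℕ) (a : A) (f : PiretAlgebra σ) (t : ℕ) :
    (zpowMul σ i a * f).coeff t = if i ≤ t then (σ ^ (t - i)) a * f.coeff (t - i) else 0 := by
  rw [coeff_mul]
  split_ifs with h
  · rw [Finset.sum_eq_single (i, t - i)]
    · simp [coeff_zpowMul]
    · rintro ⟨x, y⟩ hxy hne
      rw [Finset.HasAntidiagonal.mem_antidiagonal] at hxy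
      rw [coeff_zpowMul, if_neg, map_zero, zero_mul]
      rintro rfl
      exact hne (Prod.ext rfl (by simp only at hxy ⊢; omega))
    · intro hn
      exact (hn (by rw [Finset.HasAntidiagonal.mem_antidiagonal]; simp only; omega)).elim
  · refine Finset.sum_eq_zero ?_
    rintro ⟨x, y⟩ hxy
    rw [Finset.HasAntidiagonal.mem_antidiagonal] at hxy
    rw [coeff_zpowMul, if_neg, map_zero, zero_mul]
    rintro rfl
    exact h (by simp only at hxy; omega)

theorem const_mul_coeff (a : A) (f : PiretAlgebra σ) (t : ℕ) :
    (const σ a * f).coeff t = (σ ^ t) a * f.coeff t := by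
  simp [const, zpowMul_mul_coeff]

theorem zpowMul_mul_zpowMul (i j : ℕ) (a b : A) :
    zpowMul σ i a * zpowMul σ j b = zpowMul σ (i + j) ((σ ^ j) a * b) := by
  ext t
  rw [zpowMul_mul_coeff, coeff_zpowMul, coeff_zpowMul]
  by_cases h : i + j = t
  · subst h
    simp
  · rw [if_neg h]
    split_ifs
    · omega
    · simp
    · rfl

theorem zpowMul_add (i : ℕ) (a b : A) : zpowMul σ i (a + b) = zpowMul σ i a + zpowMul σ i b := by
  ext t
  rw [coeff_add, coeff_zpowMul, coeff_zpowMul, coeff_zpowMul]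
  split_ifs <;> simp

theorem zpowMul_zero (i : ℕ) : zpowMul σ i (0 : A) = 0 := by
  ext t
  rw [coeff_zpowMul, coeff_zero, ite_self]

variable (σ) in
/-- The inclusion `A → A[z;σ]` as a ring homomorphism. -/
def constHom : A →+* PiretAlgebra σ where
  toFun := const σ
  map_one' := rfl
  map_mul' a b := by simp [const, zpowMul_mul_zpowMul]
  map_zero' := zpowMul_zero 0
  map_add' := zpowMul_add 0

theorem constHom_apply (a : A) : constHom σ a = const σ a := rfl

theorem pow_z (k : ℕ) : zpowMul σ 1 (1 : A) ^ k = zpowMul σ k 1 := by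
  induction k with
  | zero => rfl
  | succ k ih => rw [pow_succ, ih, zpowMul_mul_zpowMul]; simp

variable (σ) in
/-- The embedding of the central-scalar polynomial ring `F[z]` in `A[z;σ]`. -/
def polyHom : F[X] →+* PiretAlgebra σ :=
  -- Scalars from F commute with z because σ fixes them.
  eval₂RingHom' ((constHom σ).comp (algebraMap F A)) (zpowMul σ 1 1) fun c => by
    simp [Commute, SemiconjBy, constHom_apply, const, zpowMul_mul_zpowMul]

theorem polyHom_monomial (k : ℕ) (c : F) :
    polyHom σ (monomial k c) = zpowMul σ k (algebraMap F A c) := by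
  change eval₂ _ _ _ = _
  rw [eval₂_monomial, pow_z]
  simp [constHom_apply, const, zpowMul_mul_zpowMul]

/-- `A[z;σ]` as a left module over `F[z]`. -/
instance : Module F[X] (PiretAlgebra σ) := Module.compHom _ (polyHom σ)

theorem poly_smul_def (f : F[X]) (x : PiretAlgebra σ) : f • x = polyHom σ f * x := rfl

/-- In general z is not central, so this is not an algebra over F[z]; associativity alone makes
right multiplications F[z]-linear. -/
instance : IsScalarTower F[X] (PiretAlgebra σ) (PiretAlgebra σ) where
  smul_assoc f x y := mul_assoc (polyHom σ f) x y

theorem coeff_poly_smul (f : F[X]) (x : PiretAlgebra σ) (t : ℕ) :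
    (f • x).coeff t = ∑ p ∈ Finset.HasAntidiagonal.antidiagonal t, f.coeff p.1 • x.coeff p.2 := by
  induction f using Polynomial.induction_on' with
  | add f g hf hg => simp [add_smul, coeff_add, hf, hg, Finset.sum_add_distrib]
  | monomial k c =>
    rw [poly_smul_def, polyHom_monomial, coeff_mul]
    refine Finset.sum_congr rfl fun p _ => ?_
    rw [coeff_zpowMul, coeff_monomial, Algebra.smul_def]
    split_ifs <;> simp

theorem C_smul_const (c : F) (a : A) : (C c : F[X]) • const σ a = const σ (c • a) := by
  rw [poly_smul_def, ← monomial_zero_left, polyHom_monomial, Algebra.smul_def]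
  exact ((constHom σ).map_mul _ _).symm

end PiretAlgebra

end CyclicConv

namespace CyclicConv

/-- The power basis of `F[x]/(p)`, indexed by the numbers below `deg p`. -/
def adjoinRootBasis {F : Type*} [Field F] {p : F[X]} (hp : p.Monic) :
    Module.Basis (Fin p.natDegree) F (AdjoinRoot p) :=
  (AdjoinRoot.powerBasis' hp).basis

theorem adjoinRootBasis_apply {F : Type*} [Field F] {p : F[X]} (hp : p.Monic)
    (s : Fin p.natDegree) : adjoinRootBasis hp s = AdjoinRoot.root p ^ (s : ℕ) :=
  (AdjoinRoot.powerBasis' hp).basis_eq_pow s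

/-! ### Coordinates on `A` and the `F[z]`-isomorphism `𝔭` -/

section Coordinates

variable {F : Type*} [Field F] {n : ℕ}

/-- The map `F^n → A` as a linear map. -/
def toCyclicRingLinear (F : Type*) [Field F] (n : ℕ) : (Fin n → F) →ₗ[F] CyclicRing F n where
  toFun := toCyclicRing
  map_add' v w := by simp [toCyclicRing, add_smul, Finset.sum_add_distrib]
  map_smul' c v := by simp [toCyclicRing, mul_smul, Finset.smul_sum]

theorem toCyclicRingLinear_apply (v : Fin n → F) :
    toCyclicRingLinear F n v = toCyclicRing v := rfl

theorem toCyclicRingLinear_bijective (hn : n ≠ 0) :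
    Function.Bijective (toCyclicRingLinear F n) := by
  have hm : (X ^ n - 1 : F[X]).Monic := by simpa using monic_X_pow_sub_C (1 : F) hn
  have hd : (X ^ n - 1 : F[X]).natDegree = n := by
    simpa using natDegree_X_pow_sub_C (n := n) (r := (1 : F))
  let b : Module.Basis (Fin n) F (CyclicRing F n) :=
    (adjoinRootBasis hm).reindex (finCongr hd)
  have h : toCyclicRingLinear F n = (b.equivFun.symm : (Fin n → F) →ₗ[F] CyclicRing F n) := by
    ext v
    simp [b, toCyclicRingLinear_apply, toCyclicRing, Module.Basis.equivFun_symm_apply,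
      adjoinRootBasis_apply]
  rw [h]
  exact b.equivFun.symm.bijective

variable (σ : CyclicRing F n ≃ₐ[F] CyclicRing F n)

/-- The map `𝔭` as an `F[z]`-linear map. -/
def toPiretLinear : (Fin n → F[X]) →ₗ[F[X]] PiretAlgebra σ where
  toFun := toPiret σ
  map_add' v w := by
    ext j
    simp only [PiretAlgebra.coeff_add, coeff_toPiret, ← toCyclicRingLinear_apply, ← map_add]
    congr 1
  map_smul' f v := by
    ext j
    simp only [RingHom.id_apply, PiretAlgebra.coeff_poly_smul, coeff_toPiret,
      ← toCyclicRingLinear_apply, ← map_smul, ← map_sum]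
    congr 1
    funext i
    simp [Polynomial.coeff_mul]

theorem toPiretLinear_apply (v : Fin n → F[X]) : toPiretLinear σ v = toPiret σ v := rfl

theorem toPiretLinear_single (i : Fin n) :
    toPiretLinear σ (Pi.single i 1) =
      PiretAlgebra.const σ (AdjoinRoot.root (X ^ n - 1 : F[X]) ^ (i : ℕ)) := by
  classical
  ext j
  rw [toPiretLinear_apply, coeff_toPiret, PiretAlgebra.const, PiretAlgebra.coeff_zpowMul,
    toCyclicRing, Finset.sum_eq_single i]
  · rw [Pi.single_eq_same, coeff_one]
    simp [eq_comm]
  · intro k _ hk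
    rw [Pi.single_eq_of_ne hk]
    simp
  · simp

theorem toPiretLinear_bijective (hn : n ≠ 0) : Function.Bijective (toPiretLinear σ) := by
  constructor
  · intro v w h
    funext i
    ext j
    have h1 := congrArg (fun x => PiretAlgebra.coeff x j) h
    simp only [toPiretLinear_apply, coeff_toPiret] at h1
    exact congrFun ((toCyclicRingLinear_bijective hn).1 h1) i
  · intro y
    choose c hc using fun j => (toCyclicRingLinear_bijective hn).2 (y.coeff j)
    let s : Finset ℕ := SkewPolynomial.support (MulOpposite.unop y)
    have hs : ∀ j, j ∉ s → y.coeff j = 0 := fun j hj => SkewPolynomial.notMem_support_iff.1 hj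
    refine ⟨fun i => ∑ j ∈ s, monomial j (c j i), ?_⟩
    ext j
    rw [toPiretLinear_apply, coeff_toPiret]
    have : (fun i => (∑ j ∈ s, monomial j (c j i)).coeff j) = if j ∈ s then c j else 0 := by
      funext i
      simp only [finsetSum_coeff, coeff_monomial, Finset.sum_ite_eq']
      split_ifs <;> rfl
    rw [this]
    split_ifs with h
    · exact hc j
    · rw [hs j h]
      exact map_zero (toCyclicRingLinear F n)

/-- `𝔭` as an `F[z]`-linear isomorphism. -/
def toPiretEquiv (hn : n ≠ 0) : (Fin n → F[X]) ≃ₗ[F[X]] PiretAlgebra σ :=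
  LinearEquiv.ofBijective (toPiretLinear σ) (toPiretLinear_bijective σ hn)

theorem toPiretEquiv_apply (hn : n ≠ 0) (v : Fin n → F[X]) :
    toPiretEquiv σ hn v = toPiret σ v := rfl

theorem toCyclicRing_coeff_toPiretEquiv_symm (hn : n ≠ 0) (y : PiretAlgebra σ) (j : ℕ) :
    (toCyclicRing fun i => ((toPiretEquiv σ hn).symm y i).coeff j) = y.coeff j := by
  rw [← coeff_toPiret σ, ← toPiretEquiv_apply σ hn, LinearEquiv.apply_symm_apply]

/-- Reduces statements about the left ideal of g to products a g with a in A. -/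
theorem span_range_const (hn : n ≠ 0) :
    Submodule.span F[X] (Set.range (PiretAlgebra.const σ)) = ⊤ := by
  classical
  rw [eq_top_iff]
  intro x _
  obtain ⟨v, rfl⟩ := (toPiretLinear_bijective σ hn).2 x
  have h : v = ∑ i, v i • (Pi.single i 1 : Fin n → F[X]) := by
    rw [← Finset.univ_sum_single v]
    refine Finset.sum_congr rfl fun i _ => ?_
    simp [← Pi.single_smul]
  rw [h, map_sum]
  refine Submodule.sum_mem _ fun i _ => ?_
  rw [map_smul, toPiretLinear_single]
  exact Submodule.smul_mem _ _ (Submodule.subset_span ⟨_, rfl⟩)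

end Coordinates

/-! ### Primitive idempotents and their orbits under `σ` -/

section Orbits

variable {F : Type*} [Field F] {n r : ℕ} {π : Fin r → F[X]} (hπ : IsPrimeFactorization n π)

theorem crt_apply (a : CyclicRing F n) (k : Fin r) : crt hπ a k = proj hπ k a := rfl

theorem crt_idem (k : Fin r) : crt hπ (idem hπ k) = Pi.single k 1 :=
  RingEquiv.apply_symm_apply _ _

theorem crt_idem_mul (k : Fin r) (a : CyclicRing F n) :
    crt hπ (idem hπ k * a) = Pi.single k (proj hπ k a) := by
  classical
  rw [map_mul, crt_idem]
  funext j
  by_cases h : j = k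
  · subst h
    simp [crt_apply]
  · simp [Pi.single_eq_of_ne h]

/-- By the Chinese remainder theorem, identities in ε_k A can be checked in the field F[x]/(π_k). -/
theorem idem_mul_eq_iff (k : Fin r) (a b : CyclicRing F n) :
    idem hπ k * a = idem hπ k * b ↔ proj hπ k a = proj hπ k b := by
  rw [← (crt hπ).injective.eq_iff, crt_idem_mul, crt_idem_mul]
  exact (Pi.single_injective k).eq_iff

theorem proj_idem_self (k : Fin r) : proj hπ k (idem hπ k) = 1 := by
  rw [← crt_apply, crt_idem, Pi.single_eq_same]

theorem idem_mul_self (k : Fin r) : idem hπ k * idem hπ k = idem hπ k := by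
  conv_rhs => rw [← mul_one (idem hπ k)]
  rw [idem_mul_eq_iff, proj_idem_self, map_one]

theorem idem_ne_zero (k : Fin r) : idem hπ k ≠ 0 := by
  have : Fact (Irreducible (π k)) := ⟨hπ.irreducible k⟩
  intro h
  have h1 := proj_idem_self hπ k
  rw [h, map_zero] at h1
  exact zero_ne_one h1

theorem idem_mul_of_idempotent (k : Fin r) {f : CyclicRing F n} (hf : f * f = f) :
    idem hπ k * f = 0 ∨ idem hπ k * f = idem hπ k := by
  have : Fact (Irreducible (π k)) := ⟨hπ.irreducible k⟩
  have h : proj hπ k f * proj hπ k f = proj hπ k f := by rw [← map_mul, hf]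
  rcases IsIdempotentElem.iff_eq_zero_or_one.1 h with h | h
  · left
    rw [← mul_zero (idem hπ k), idem_mul_eq_iff, h, map_zero]
  · right
    conv_rhs => rw [← mul_one (idem hπ k)]
    rw [idem_mul_eq_iff, h, map_one]

variable (σ : CyclicRing F n ≃ₐ[F] CyclicRing F n)

theorem pow_idem_mul_of_idempotent (a : ℕ) (k : Fin r) {f : CyclicRing F n} (hf : f * f = f) :
    (σ ^ a) (idem hπ k) * f = 0 ∨ (σ ^ a) (idem hπ k) * f = (σ ^ a) (idem hπ k) := by
  obtain ⟨f, rfl⟩ := (σ ^ a).surjective f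
  rw [← map_mul] at hf
  rw [← map_mul]
  rcases idem_mul_of_idempotent hπ k ((σ ^ a).injective hf) with h | h
  · left
    rw [h, map_zero]
  · right
    rw [h]

theorem pow_idem_mul_self (a : ℕ) (k : Fin r) :
    (σ ^ a) (idem hπ k) * (σ ^ a) (idem hπ k) = (σ ^ a) (idem hπ k) := by
  rw [← map_mul, idem_mul_self]

/-- The product of two primitive idempotents is zero or equals each factor. Working with powers of σ
directly avoids constructing the permutation Π_σ. -/
theorem pow_idem_mul_pow_idem (a b : ℕ) (k l : Fin r) :
    (σ ^ a) (idem hπ k) * (σ ^ b) (idem hπ l) = 0 ∨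
      (σ ^ a) (idem hπ k) = (σ ^ b) (idem hπ l) := by
  rcases pow_idem_mul_of_idempotent hπ σ a k (pow_idem_mul_self hπ σ b l) with h | h
  · exact .inl h
  rcases pow_idem_mul_of_idempotent hπ σ b l (pow_idem_mul_self hπ σ a k) with h' | h'
  · left
    rw [mul_comm, h']
  · right
    rw [← h, mul_comm, h']

theorem sigmaEquiv_of_pow_eq {a b : ℕ} {k l : Fin r} (hab : b ≤ a)
    (h : (σ ^ a) (idem hπ k) = (σ ^ b) (idem hπ l)) : SigmaEquiv hπ σ k l := by
  refine ⟨a - b, (σ ^ b).injective ?_⟩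
  rw [← AlgEquiv.mul_apply, ← pow_add, Nat.add_sub_cancel' hab, h]

/-- `SigmaEquiv` allows only nonnegative powers; cancelling the smaller exponent decides which of
the two hypotheses is contradicted. -/
theorem pow_idem_ne_pow_idem {k l : Fin r} (h : ¬ SigmaEquiv hπ σ k l)
    (h' : ¬ SigmaEquiv hπ σ l k) (a b : ℕ) : (σ ^ a) (idem hπ k) ≠ (σ ^ b) (idem hπ l) := by
  intro e
  rcases le_total b a with hab | hab
  · exact h (sigmaEquiv_of_pow_eq hπ σ hab e)
  · exact h' (sigmaEquiv_of_pow_eq hπ σ hab e.symm)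

theorem pow_idem_mul_pow_idem_eq_zero {k l : Fin r} (h : ¬ SigmaEquiv hπ σ k l)
    (h' : ¬ SigmaEquiv hπ σ l k) (a b : ℕ) :
    (σ ^ a) (idem hπ k) * (σ ^ b) (idem hπ l) = 0 :=
  (pow_idem_mul_pow_idem hπ σ a b k l).resolve_right (pow_idem_ne_pow_idem hπ σ h h' a b)

/-- The elements `ε_k x^s`, `s < deg π_k`, forming an `F`-basis of `ε_k A`. -/
def blockBasis (k : Fin r) (s : Fin (π k).natDegree) : CyclicRing F n :=
  idem hπ k * AdjoinRoot.root (X ^ n - 1 : F[X]) ^ (s : ℕ)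

theorem idem_mul_blockBasis (k : Fin r) (s : Fin (π k).natDegree) :
    idem hπ k * blockBasis hπ k s = blockBasis hπ k s := by
  rw [blockBasis, ← mul_assoc, idem_mul_self]

theorem proj_root_pow (k : Fin r) (s : Fin (π k).natDegree) :
    proj hπ k (AdjoinRoot.root (X ^ n - 1 : F[X]) ^ (s : ℕ)) =
      (adjoinRootBasis (hπ.monic k)) s := by
  rw [adjoinRootBasis_apply, map_pow]
  congr 1
  exact AdjoinRoot.algHomOfDvd_root ..

theorem idem_mul_mem_span_blockBasis (k : Fin r) (a : CyclicRing F n) :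
    idem hπ k * a ∈ Submodule.span F (Set.range (blockBasis hπ k)) := by
  let c := (adjoinRootBasis (hπ.monic k)).repr (proj hπ k a)
  have h : idem hπ k * a = ∑ s : Fin (π k).natDegree, c s • blockBasis hπ k s := by
    simp only [blockBasis, ← mul_smul_comm, ← Finset.mul_sum]
    rw [idem_mul_eq_iff, map_sum]
    simp only [map_smul, proj_root_pow]
    exact ((adjoinRootBasis (hπ.monic k)).sum_repr _).symm
  rw [h]
  exact Submodule.sum_mem _ fun s _ => Submodule.smul_mem _ _ (Submodule.subset_span ⟨s, rfl⟩)

theorem linearIndependent_blockBasis (k : Fin r) :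
    LinearIndependent F (blockBasis hπ k) := by
  apply LinearIndependent.of_comp (proj hπ k).toLinearMap
  have h : (proj hπ k).toLinearMap ∘ blockBasis hπ k = adjoinRootBasis (hπ.monic k) := by
    funext s
    change proj hπ k (idem hπ k * _) = _
    rw [map_mul, proj_idem_self, one_mul, proj_root_pow]
  rw [h]
  exact (adjoinRootBasis (hπ.monic k)).linearIndependent

/-- Multiplying a relation by σ^{D_j}(ε_{l_j}) kills every block but the j-th, and σ^{D_j} is
injective. The exponents `D = d` give the leading coefficients of the rows, `D = 0` the constants
themselves. -/
theorem linearIndependent_pow_blockBasis {t : ℕ} (l : Fin t → Fin r)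
    (hl : ∀ i j : Fin t, i ≠ j → ¬ SigmaEquiv hπ σ (l i) (l j)) (D : Fin t → ℕ) :
    LinearIndependent F fun q : (i : Fin t) × Fin (π (l i)).natDegree =>
      (σ ^ D q.1) (blockBasis hπ (l q.1) q.2) := by
  rw [Fintype.linearIndependent_iff]
  rintro c hc ⟨j, s⟩
  have h1 : (σ ^ D j) (∑ s, c ⟨j, s⟩ • blockBasis hπ (l j) s) = 0 := by
    rw [← mul_zero ((σ ^ D j) (idem hπ (l j))), ← hc, Fintype.sum_sigma, Finset.mul_sum,
      Finset.sum_eq_single j]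
    · rw [map_sum, Finset.mul_sum]
      refine Finset.sum_congr rfl fun s _ => ?_
      rw [mul_smul_comm, ← map_mul, idem_mul_blockBasis, map_smul]
    · intro i _ hij
      rw [Finset.mul_sum]
      refine Finset.sum_eq_zero fun s _ => ?_
      rw [mul_smul_comm]
      dsimp only
      rw [← idem_mul_blockBasis, map_mul, ← mul_assoc,
        pow_idem_mul_pow_idem_eq_zero hπ σ (hl j i hij.symm) (hl i j hij), zero_mul, smul_zero]
    · simp
  rw [EmbeddingLike.map_eq_zero_iff] at h1
  exact Fintype.linearIndependent_iff.1 (linearIndependent_blockBasis hπ (l j)) _ h1 s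

end Orbits
end CyclicConv

namespace CyclicConv

/-! ### Generators of prescribed degrees -/

namespace PiretAlgebra

variable {F A : Type*} [CommSemiring F] [CommRing A] [Algebra F A] (σ : A ≃ₐ[F] A)

theorem pow_mul_eq_zero_of_orthogonal {ε ε' x y : A} {a b : ℕ}
    (h : (σ ^ a) ε * (σ ^ b) ε' = 0) (hx : ε * x = x) (hy : ε' * y = y) :
    (σ ^ a) x * (σ ^ b) y = 0 := by
  rw [← hx, ← hy, map_mul, map_mul, mul_mul_mul_comm, h, zero_mul]

/-- Products of elementary units `1 + N` yield a polynomial `g` that generates the image of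
`A[z;σ] e`, `e = ∑ ε_i`, under a unit, with components of controlled shape. -/
theorem exists_generator_of_shift {t : ℕ} (ε α β : Fin t → A) (p : Fin t → ℕ)
    (horth : ∀ i j, i ≠ j → ∀ a b : ℕ, (σ ^ a) (ε i) * (σ ^ b) (ε j) = 0)
    (hidem : ∀ i, ε i * ε i = ε i) (hα : ∀ i, ε i * α i = α i) (hβ : ∀ i, ε i * β i = β i)
    (hαα : ∀ i, (σ ^ p i) (α i) * α i = 0) (hεβ : ∀ i, σ (ε i) * β i = 0) :
    ∃ g v : PiretAlgebra σ, const σ (∑ i, ε i) * g = g ∧ g * v = const σ (∑ i, ε i) ∧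
      ∀ i, const σ (ε i) * g = const σ (ε i) + zpowMul σ (p i) ((σ ^ p i) (α i)) +
        zpowMul σ (p i + 1) ((σ ^ (p i + 1)) (α i) * β i) := by
  -- This is α_i z^{p_i} with the coefficient moved to the right of z.
  let M : Fin t → PiretAlgebra σ := fun i => zpowMul σ (p i) ((σ ^ p i) (α i))
  let N₁ := ∑ i, M i
  let N₂ := ∑ i, zpowMul σ 1 (β i)
  have he : const σ (∑ i, ε i) = ∑ i, const σ (ε i) := map_sum (constHom σ) ε Finset.univ
  have hεe : ∀ i, const σ (ε i) * const σ (∑ i, ε i) = const σ (ε i) := fun i => by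
    rw [← constHom_apply, ← constHom_apply, ← map_mul, Finset.mul_sum, Finset.sum_eq_single i,
      hidem]
    · intro j _ hj
      simpa using horth i j hj.symm 0 0
    · simp
  have hεN₁ : ∀ i, const σ (ε i) * N₁ = M i := fun i => by
    rw [Finset.mul_sum, Finset.sum_eq_single i]
    · rw [const, zpowMul_mul_zpowMul, ← map_mul, hα, zero_add]
    · intro j _ hj
      rw [const, zpowMul_mul_zpowMul,
        pow_mul_eq_zero_of_orthogonal σ (horth i j hj.symm _ _) (hidem i) (hα j), zpowMul_zero]
    · simp
  have hεN₂ : ∀ i, const σ (ε i) * N₂ = 0 := fun i => by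
    rw [Finset.mul_sum]
    refine Finset.sum_eq_zero fun j _ => ?_
    rw [const, zpowMul_mul_zpowMul]
    by_cases hj : j = i
    · rw [hj, pow_one, hεβ, zpowMul_zero]
    · have := pow_mul_eq_zero_of_orthogonal σ (horth i j (Ne.symm hj) 1 0) (hidem i) (hβ j)
      rw [pow_zero, AlgEquiv.one_apply] at this
      rw [this, zpowMul_zero]
  have hMN₁ : ∀ i, M i * N₁ = 0 := fun i => by
    rw [Finset.mul_sum]
    refine Finset.sum_eq_zero fun j _ => ?_
    rw [zpowMul_mul_zpowMul, ← map_mul]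
    by_cases hj : j = i
    · rw [hj, hαα, map_zero, zpowMul_zero]
    · have := pow_mul_eq_zero_of_orthogonal σ (horth i j (Ne.symm hj) (p i) 0) (hα i) (hα j)
      rw [pow_zero, AlgEquiv.one_apply] at this
      rw [this, map_zero, zpowMul_zero]
  have hMN₂ : ∀ i, M i * N₂ = zpowMul σ (p i + 1) ((σ ^ (p i + 1)) (α i) * β i) := fun i => by
    have hpow : ∀ x, (σ ^ 1) ((σ ^ p i) x) = (σ ^ (p i + 1)) x := fun x => by
      rw [← AlgEquiv.mul_apply, ← pow_add, add_comm]
    rw [Finset.mul_sum, Finset.sum_eq_single i]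
    · rw [zpowMul_mul_zpowMul, hpow]
    · intro j _ hj
      have := pow_mul_eq_zero_of_orthogonal σ (horth i j hj.symm (p i + 1) 0) (hα i) (hβ j)
      rw [pow_zero, AlgEquiv.one_apply] at this
      rw [zpowMul_mul_zpowMul, hpow, this, zpowMul_zero]
    · simp
  have heN₁ : const σ (∑ i, ε i) * N₁ = N₁ := by
    rw [he, Finset.sum_mul]
    exact Finset.sum_congr rfl fun i _ => hεN₁ i
  have hN₁N₁ : N₁ * N₁ = 0 := by
    conv_lhs => rw [Finset.sum_mul]
    exact Finset.sum_eq_zero fun i _ => hMN₁ i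
  have hN₂N₂ : N₂ * N₂ = 0 := by
    conv_lhs => rw [Finset.sum_mul_sum]
    refine Finset.sum_eq_zero fun i _ => Finset.sum_eq_zero fun j _ => ?_
    rw [zpowMul_mul_zpowMul]
    by_cases hj : j = i
    · rw [hj, pow_one, ← hβ i, map_mul, mul_right_comm, hβ, hεβ, zero_mul, zpowMul_zero]
    · have := pow_mul_eq_zero_of_orthogonal σ (horth i j (Ne.symm hj) 1 0) (hβ i) (hβ j)
      rw [pow_zero, AlgEquiv.one_apply] at this
      rw [this, zpowMul_zero]
  have hee : const σ (∑ i, ε i) * const σ (∑ i, ε i) = const σ (∑ i, ε i) := by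
    conv_lhs => enter [1]; rw [he]
    rw [Finset.sum_mul, he]
    refine Finset.sum_congr rfl fun i _ => ?_
    rw [← he, hεe]
  generalize const σ (∑ i, ε i) = e at *
  -- Since e N₁ = N₁, the first factor is e(1 + N₁), so g is e times a unit and v is the inverse of
  -- that unit.
  refine ⟨(e + N₁) * (1 + N₂), (1 - N₂) * (1 - N₁), ?_, ?_, fun i => ?_⟩
  · rw [← mul_assoc, mul_add e e N₁, hee, heN₁]
  · calc (e + N₁) * (1 + N₂) * ((1 - N₂) * (1 - N₁))
        = (e + N₁) * (1 - N₂ * N₂) * (1 - N₁) := by noncomm_ring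
      _ = e + N₁ - e * N₁ - N₁ * N₁ := by rw [hN₂N₂]; noncomm_ring
      _ = e := by rw [heN₁, hN₁N₁]; abel
  · rw [← mul_assoc, mul_add _ e N₁, hεe, hεN₁, mul_add, mul_one, add_mul, hεN₂, zero_add, hMN₂]

/-- Chooses the shifts for each i separately, according to whether d_i is zero, σ^{d_i} moves ε_i,
or σ^{d_i} fixes ε_i with d_i positive. -/
theorem exists_generator {t : ℕ} (ε : Fin t → A) (d : Fin t → ℕ)
    (horth : ∀ i j, i ≠ j → ∀ a b : ℕ, (σ ^ a) (ε i) * (σ ^ b) (ε j) = 0)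
    (hidem : ∀ i, ε i * ε i = ε i)
    (hdich : ∀ i (a : ℕ), (σ ^ a) (ε i) * ε i = 0 ∨ (σ ^ a) (ε i) = ε i)
    (hmove : ∀ i, σ (ε i) ≠ ε i) :
    ∃ g v : PiretAlgebra σ, const σ (∑ i, ε i) * g = g ∧ g * v = const σ (∑ i, ε i) ∧
      ∀ i, (∀ j, d i < j → (const σ (ε i) * g).coeff j = 0) ∧
        (const σ (ε i) * g).coeff (d i) = (σ ^ d i) (ε i) := by
  have hσε : ∀ i, σ (ε i) * ε i = 0 := fun i => by
    simpa using (hdich i 1).resolve_right (by simpa using hmove i)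
  have key : ∀ i, ∃ (p : ℕ) (α β : A), ε i * α = α ∧ ε i * β = β ∧ (σ ^ p) α * α = 0 ∧
      σ (ε i) * β = 0 ∧ ∀ f : PiretAlgebra σ, f = const σ (ε i) + zpowMul σ p ((σ ^ p) α) +
        zpowMul σ (p + 1) ((σ ^ (p + 1)) α * β) →
        (∀ j, d i < j → f.coeff j = 0) ∧ f.coeff (d i) = (σ ^ d i) (ε i) := by
    intro i
    by_cases h0 : d i = 0
    · refine ⟨0, 0, 0, by simp, by simp, by simp, by simp, ?_⟩
      rintro _ rfl
      simp only [map_zero, zero_mul, zpowMul_zero, add_zero, const, coeff_zpowMul, h0, if_true,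
        pow_zero, AlgEquiv.one_apply, and_true]
      exact fun j hj => if_neg hj.ne
    rcases hdich i (d i) with h1 | h1
    · refine ⟨d i, ε i, 0, hidem i, by simp, h1, by simp, ?_⟩
      rintro _ rfl
      simp only [mul_zero, zpowMul_zero, add_zero, const, coeff_zpowMul, coeff_add, if_true,
        if_neg (Ne.symm h0), zero_add, and_true]
      intro j hj
      rw [if_neg (by omega), if_neg (by omega), add_zero]
    · obtain ⟨m, hm⟩ := Nat.exists_eq_succ_of_ne_zero h0
      have hm' : (σ ^ (m + 1)) (ε i) = ε i := by rw [← Nat.succ_eq_add_one, ← hm, h1]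
      -- Here d_i = m + 1. If σ^m also fixed ε_i, so would σ; hence the shift by z^m squares to
      -- zero, and the second shift raises its degree to d_i.
      refine ⟨m, ε i, ε i, hidem i, hidem i, (hdich i m).resolve_right fun h => hmove i ?_,
        hσε i, ?_⟩
      · rw [pow_succ', AlgEquiv.mul_apply, h] at hm'
        exact hm'
      rintro _ rfl
      simp only [const, coeff_zpowMul, coeff_add, h1]
      rw [hm, hm', hidem]
      constructor
      · intro j hj
        rw [if_neg (by omega), if_neg (by omega), if_neg (by omega)]
        simp
      · simp
  choose p α β hα hβ hαα hεβ hshape using key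
  obtain ⟨g, v, h1, h2, h3⟩ :=
    exists_generator_of_shift σ ε α β p horth hidem hα hβ hαα hεβ
  exact ⟨g, v, h1, h2, fun i => hshape i _ (h3 i)⟩

end PiretAlgebra
end CyclicConv

namespace CyclicConv

/-! ### Right multiplication by idempotents -/

namespace PiretAlgebra

variable {F A : Type*} [CommSemiring F] [CommRing A] [Algebra F A] {σ : A ≃ₐ[F] A}

theorem coeff_poly_smul_const (f : F[X]) (a : A) (j : ℕ) :
    (f • const σ a).coeff j = f.coeff j • a := by
  rw [coeff_poly_smul, Finset.sum_eq_single (j, 0)]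
  · simp [const, coeff_zpowMul]
  · rintro ⟨x, y⟩ hxy hne
    have hy : y ≠ 0 := by
      rintro rfl
      rw [Finset.HasAntidiagonal.mem_antidiagonal] at hxy
      exact hne (Prod.ext (by simpa using hxy) rfl)
    rw [const, coeff_zpowMul, if_neg hy.symm, smul_zero]
  · intro h
    exact (h (by rw [Finset.HasAntidiagonal.mem_antidiagonal]; simp)).elim

theorem linearIndependent_const {ι : Type*} [Fintype ι] {b : ι → A}
    (hb : LinearIndependent F b) : LinearIndependent F[X] fun q => const σ (b q) := by
  rw [Fintype.linearIndependent_iffₛ] at hb ⊢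
  intro f g hfg q
  ext j
  refine hb (fun q => (f q).coeff j) (fun q => (g q).coeff j) ?_ q
  simpa only [coeff_sum, coeff_poly_smul_const] using congrArg (fun x => x.coeff j) hfg

/-- v(g v)g = v(e g) = v g. -/
theorem isIdempotentElem_mulRight {e g v : PiretAlgebra σ} (h1 : e * g = g) (h2 : g * v = e) :
    IsIdempotentElem (LinearMap.mulRight F[X] (v * g)) := by
  ext1 x
  change x * (v * g) * (v * g) = x * (v * g)
  rw [mul_assoc, mul_assoc v g, ← mul_assoc g v, h2, h1]

/-- x g = x(e g) = (x g)(v g), while x(v g) = (x v)g. -/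
theorem exists_mul_eq_iff {e g v : PiretAlgebra σ} (h1 : e * g = g) (h2 : g * v = e)
    (y : PiretAlgebra σ) :
    (∃ x, x * g = y) ↔ y ∈ LinearMap.range (LinearMap.mulRight F[X] (v * g)) := by
  constructor
  · rintro ⟨x, rfl⟩
    refine ⟨x * g, ?_⟩
    change x * g * (v * g) = x * g
    rw [mul_assoc, ← mul_assoc g v, h2, h1]
  · rintro ⟨x, rfl⟩
    exact ⟨x * v, mul_assoc _ _ _⟩

end PiretAlgebra

/-! ### Right invertibility of generator matrices -/

/-- Projecting onto the row space along `D` and then inverting u ↦ uG gives a linear retraction of u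
↦ uG; its matrix is the right inverse. -/
theorem exists_rightInverse_of_isCompl {R : Type*} [CommRing R] {k n : ℕ}
    (G : Matrix (Fin k) (Fin n) R) (hG : LinearIndependent R G.row)
    {D : Submodule R (Fin n → R)} (hD : IsCompl (LinearMap.range G.vecMulLinear) D) :
    ∃ G' : Matrix (Fin n) (Fin k) R, G * G' = 1 := by
  have hinj : Function.Injective G.vecMulLinear := Matrix.vecMul_injective_iff.2 hG
  let H : (Fin n → R) →ₗ[R] (Fin k → R) :=
    (LinearEquiv.ofInjective G.vecMulLinear hinj).symm.toLinearMap ∘ₗ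
      (LinearMap.range G.vecMulLinear).projectionOnto D hD
  have hH : H ∘ₗ G.vecMulLinear = LinearMap.id := by
    refine LinearMap.ext fun x => ?_
    change (LinearEquiv.ofInjective G.vecMulLinear hinj).symm
      ((LinearMap.range G.vecMulLinear).projectionOnto D hD
        (LinearEquiv.ofInjective G.vecMulLinear hinj x : _)) = x
    rw [Submodule.projectionOnto_apply_left, LinearEquiv.symm_apply_apply]
  refine ⟨LinearMap.toMatrixRight' H, Matrix.toLinearMapRight'.injective ?_⟩
  rw [Matrix.toLinearMapRight'_mul, Matrix.toLinearMapRight'_one]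
  refine Eq.trans ?_ hH
  congr 1
  exact Matrix.toLinearMapRight'.apply_symm_apply H

/-! ### Reduced polynomials supported on different cycles -/

section Reduced

variable {F : Type*} [Field F] {n r : ℕ} {π : Fin r → F[X]} (hπ : IsPrimeFactorization n π)
  {σ : CyclicRing F n ≃ₐ[F] CyclicRing F n}

/-- The coefficient of z^ν in ε_k f is a multiple of σ^ν(ε_k), so each degree admits only one
idempotent. -/
theorem eq_pow_idem_of_term_component_ne_zero {f : PiretAlgebra σ} {k j : Fin r} {ν : ℕ}
    (h : term hπ (component hπ f k) ν j ≠ 0) : idem hπ j = (σ ^ ν) (idem hπ k) := by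
  refine (pow_idem_mul_pow_idem hπ σ 0 ν j k).resolve_left fun h0 => h ?_
  rw [pow_zero, AlgEquiv.one_apply] at h0
  rw [term, component, PiretAlgebra.const_mul_coeff, ← mul_assoc, h0, zero_mul,
    PiretAlgebra.zpowMul_zero]

theorem term_component_eq_zero {f : PiretAlgebra σ} {k : Fin r} (h : k ∉ supp hπ f) (ν : ℕ)
    (j : Fin r) : term hπ (component hπ f k) ν j = 0 := by
  rw [supp, Set.mem_ofPred_eq, not_not] at h
  rw [h, term, PiretAlgebra.coeff_zero, mul_zero, PiretAlgebra.zpowMul_zero]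

/-- A multiple h z^μ ε_m is fixed by right multiplication by ε_m, but ε_j comes from another cycle,
so that multiplication kills a term carrying ε_j. -/
theorem isReduced_of_not_sigmaEquiv {f : PiretAlgebra σ}
    (h : ∀ k ∈ supp hπ f, ∀ l ∈ supp hπ f, k ≠ l → ¬ SigmaEquiv hπ σ k l) :
    IsReduced hπ f := by
  rintro k l hkl μ m hm ν j hj ⟨x, hx⟩
  -- Maximality of the leading monomial plays no role; any nonzero term would do.
  have hl : term hπ (component hπ f l) μ m ≠ 0 := hm.1
  have hks : k ∈ supp hπ f := by_contra fun hk => hj (term_component_eq_zero hπ hk ν j)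
  have hls : l ∈ supp hπ f := by_contra fun hk => hl (term_component_eq_zero hπ hk μ m)
  have hjm : idem hπ j ≠ idem hπ m := by
    rw [eq_pow_idem_of_term_component_ne_zero hπ hj, eq_pow_idem_of_term_component_ne_zero hπ hl]
    exact pow_idem_ne_pow_idem hπ σ (h k hks l hls hkl) (h l hls k hks hkl.symm) ν μ
  have h0 : idem hπ j * idem hπ m = 0 := by
    simpa using (pow_idem_mul_pow_idem hπ σ 0 0 j m).resolve_right (by simpa using hjm)
  apply hj
  have h1 : term hπ (component hπ f k) ν j * PiretAlgebra.const σ (idem hπ m) =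
      term hπ (component hπ f k) ν j := by
    rw [hx, mul_assoc, PiretAlgebra.const, PiretAlgebra.zpowMul_mul_zpowMul]
    simp [idem_mul_self]
  rw [← h1, term, PiretAlgebra.const, PiretAlgebra.zpowMul_mul_zpowMul, pow_zero,
    AlgEquiv.one_apply, mul_right_comm, h0, zero_mul, PiretAlgebra.zpowMul_zero]

end Reduced

/-! ### Codes generated by `g` with `e g = g` and `g v = e` -/

section Code

variable {F : Type*} [Field F] {n r : ℕ} {π : Fin r → F[X]} (hπ : IsPrimeFactorization n π)
  (σ : CyclicRing F n ≃ₐ[F] CyclicRing F n)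

/-- As e g = g, the product a g splits into the (ε_i a) g, and each ε_i A is spanned over F by its
block basis. -/
theorem const_mul_mem_span_blockBasis {t : ℕ} (l : Fin t → Fin r) (g : PiretAlgebra σ)
    (hg : PiretAlgebra.const σ (∑ i, idem hπ (l i)) * g = g) (a : CyclicRing F n) :
    PiretAlgebra.const σ a * g ∈ Submodule.span F[X]
      (Set.range fun q : (i : Fin t) × Fin (π (l i)).natDegree =>
        PiretAlgebra.const σ (blockBasis hπ (l q.1) q.2) * g) := by
  have h1 : PiretAlgebra.const σ a * g =
      ∑ i, PiretAlgebra.const σ (idem hπ (l i) * a) * g := by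
    conv_lhs => rw [← hg]
    simp only [← mul_assoc, ← Finset.sum_mul, ← PiretAlgebra.constHom_apply, ← map_mul, ← map_sum]
    rw [mul_comm a]
  rw [h1]
  refine Submodule.sum_mem _ fun i _ => ?_
  have h2 := idem_mul_mem_span_blockBasis hπ (l i) a
  generalize idem hπ (l i) * a = y at h2
  simp only [← PiretAlgebra.constHom_apply]
  induction h2 using Submodule.span_induction with
  | mem y hy =>
    obtain ⟨s, rfl⟩ := hy
    exact Submodule.subset_span ⟨⟨i, s⟩, rfl⟩
  | zero => simp
  | add x y _ _ hx hy =>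
    rw [map_add, add_mul]
    exact Submodule.add_mem _ hx hy
  | smul c x _ hx =>
    rw [PiretAlgebra.constHom_apply, ← PiretAlgebra.C_smul_const, smul_mul_assoc]
    exact Submodule.smul_mem _ _ hx

theorem span_blockBasis_mul_eq_range (hn : n ≠ 0) {t : ℕ} (l : Fin t → Fin r)
    {g v : PiretAlgebra σ} (hg : PiretAlgebra.const σ (∑ i, idem hπ (l i)) * g = g)
    (hgv : g * v = PiretAlgebra.const σ (∑ i, idem hπ (l i))) :
    Submodule.span F[X] (Set.range fun q : (i : Fin t) × Fin (π (l i)).natDegree =>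
        PiretAlgebra.const σ (blockBasis hπ (l q.1) q.2) * g) =
      LinearMap.range (LinearMap.mulRight F[X] (v * g)) := by
  apply le_antisymm
  · rw [Submodule.span_le]
    rintro _ ⟨q, rfl⟩
    exact (PiretAlgebra.exists_mul_eq_iff hg hgv _).1 ⟨_, rfl⟩
  · intro y hy
    obtain ⟨x, rfl⟩ := (PiretAlgebra.exists_mul_eq_iff hg hgv _).2 hy
    have hx : x ∈ Submodule.span F[X] (Set.range (PiretAlgebra.const σ)) := by
      rw [span_range_const σ hn]
      trivial
    have h := Submodule.mem_map_of_mem (f := LinearMap.mulRight F[X] g) hx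
    rw [Submodule.map_span] at h
    refine Submodule.span_le.2 ?_ h
    rintro _ ⟨_, ⟨a, rfl⟩, rfl⟩
    exact const_mul_mem_span_blockBasis hπ σ l g hg a

theorem sum_idem_mul_blockBasis {t : ℕ} (l : Fin t → Fin r)
    (hl : ∀ i j : Fin t, i ≠ j → ¬ SigmaEquiv hπ σ (l i) (l j)) (i : Fin t)
    (s : Fin (π (l i)).natDegree) :
    (∑ j, idem hπ (l j)) * blockBasis hπ (l i) s = blockBasis hπ (l i) s := by
  rw [Finset.sum_mul, Finset.sum_eq_single i]
  · exact idem_mul_blockBasis hπ _ _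
  · intro j _ hj
    have := pow_idem_mul_pow_idem_eq_zero hπ σ (hl j i hj) (hl i j hj.symm) 0 0
    rw [pow_zero, AlgEquiv.one_apply, AlgEquiv.one_apply] at this
    rw [← idem_mul_blockBasis, ← mul_assoc, this, zero_mul]
  · simp

theorem hasParameters_of_generator (hn : n ≠ 0) {t : ℕ} (l : Fin t → Fin r)
    (hl : ∀ i j : Fin t, i ≠ j → ¬ SigmaEquiv hπ σ (l i) (l j)) (d : Fin t → ℕ)
    {g v : PiretAlgebra σ} (hg : PiretAlgebra.const σ (∑ i, idem hπ (l i)) * g = g)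
    (hgv : g * v = PiretAlgebra.const σ (∑ i, idem hπ (l i)))
    (hdeg : ∀ i j, d i < j → (component hπ g (l i)).coeff j = 0)
    (hlead : ∀ i, (component hπ g (l i)).coeff (d i) = (σ ^ d i) (idem hπ (l i)))
    {C D : Submodule F[X] (Fin n → F[X])} (hCD : IsCompl C D)
    (hC : C.map (toPiretEquiv σ hn).toLinearMap =
      LinearMap.range (LinearMap.mulRight F[X] (v * g))) :
    HasParameters C (∑ i, (π (l i)).natDegree) (∑ i, (π (l i)).natDegree * d i) := by
  let Φ := finSigmaFinEquiv (n := fun i => (π (l i)).natDegree)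
  let b : ((i : Fin t) × Fin (π (l i)).natDegree) → CyclicRing F n :=
    fun q => blockBasis hπ (l q.1) q.2
  let y : ((i : Fin t) × Fin (π (l i)).natDegree) → PiretAlgebra σ :=
    fun q => PiretAlgebra.const σ (b q) * g
  let G : Matrix (Fin (∑ i, (π (l i)).natDegree)) (Fin n) F[X] :=
    Matrix.of fun a => (toPiretEquiv σ hn).symm (y (Φ.symm a))
  have hy : ∀ q j, (y q).coeff j =
      (σ ^ j) (b q) * (component hπ g (l q.1)).coeff j := fun q j => by
    rw [PiretAlgebra.const_mul_coeff, component, PiretAlgebra.const_mul_coeff, ← mul_assoc,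
      ← map_mul, mul_comm (b q), idem_mul_blockBasis]
  have hcoeff : ∀ a j, (toCyclicRing fun i => (G a i).coeff j) = (y (Φ.symm a)).coeff j :=
    fun a j => toCyclicRing_coeff_toPiretEquiv_symm σ hn _ j
  have hrange : LinearMap.range G.vecMulLinear = C := by
    apply Submodule.map_injective_of_injective (toPiretEquiv σ hn).injective
    refine Eq.trans ?_ hC.symm
    rw [← span_blockBasis_mul_eq_range hπ σ hn l hg hgv, range_vecMulLinear,
      Submodule.map_span, ← Set.range_comp]
    congr 1
    rw [← Φ.symm.surjective.range_comp]
    congr 1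
    funext a
    exact (toPiretEquiv σ hn).apply_symm_apply _
  have hG : LinearIndependent F[X] G.row := by
    -- Right multiplication by v turns the rows b g back into the constants b e = b.
    apply LinearIndependent.of_comp
      (LinearMap.mulRight F[X] v ∘ₗ (toPiretEquiv σ hn).toLinearMap)
    have h1 : (LinearMap.mulRight F[X] v ∘ₗ (toPiretEquiv σ hn).toLinearMap) ∘ G.row =
        (fun q => PiretAlgebra.const σ (b q)) ∘ Φ.symm := by
      funext a
      change toPiretEquiv σ hn ((toPiretEquiv σ hn).symm (y (Φ.symm a))) * v = _
      rw [LinearEquiv.apply_symm_apply, mul_assoc, hgv]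
      simp only [Function.comp_apply, ← PiretAlgebra.constHom_apply, ← map_mul]
      rw [mul_comm, sum_idem_mul_blockBasis hπ σ l hl]
    rw [h1]
    refine LinearIndependent.comp ?_ _ Φ.symm.injective
    refine PiretAlgebra.linearIndependent_const ?_
    simpa using linearIndependent_pow_blockBasis hπ σ l hl fun _ => 0
  refine ⟨G, hrange, exists_rightInverse_of_isCompl G hG (hrange ▸ hCD), ?_⟩
  -- The row of (i, s) has degree d_i and leading coefficient σ^{d_i} of the basis element; d_i is
  -- counted once for each s, hence k_i times.
  rw [complexity_eq_sum G (fun a => d (Φ.symm a).1)]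
  · rw [Φ.symm.sum_comp fun q => d q.1, Fintype.sum_sigma]
    simp
  · intro a j
    rw [natDegree_le_iff_coeff_eq_zero]
    intro N hN
    have h1 : toCyclicRingLinear F n (fun i => (G a i).coeff N) = 0 := by
      rw [toCyclicRingLinear_apply, hcoeff, hy, hdeg _ _ hN, mul_zero]
    rw [← map_zero (toCyclicRingLinear F n)] at h1
    exact congrFun ((toCyclicRingLinear_bijective hn).1 h1) j
  · apply LinearIndependent.of_comp (toCyclicRingLinear F n)
    have h1 : (toCyclicRingLinear F n) ∘ (fun a i => (G a i).coeff (d (Φ.symm a).1)) =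
        (fun q => (σ ^ d q.1) (b q)) ∘ Φ.symm := by
      funext a
      rw [Function.comp_apply, toCyclicRingLinear_apply, hcoeff, hy, hlead, ← map_mul, mul_comm,
        idem_mul_blockBasis]
      rfl
    rw [h1]
    exact (linearIndependent_pow_blockBasis hπ σ l hl d).comp _ Φ.symm.injective

/-- Outside the range, ε_k e = 0 and e g = g kill the component; inside, the leading coefficient is
nonzero. -/
theorem supp_eq_range {t : ℕ} (l : Fin t → Fin r) (d : Fin t → ℕ) {g : PiretAlgebra σ}
    (hg : PiretAlgebra.const σ (∑ i, idem hπ (l i)) * g = g)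
    (hlead : ∀ i, (component hπ g (l i)).coeff (d i) = (σ ^ d i) (idem hπ (l i))) :
    supp hπ g = Set.range l := by
  apply Set.Subset.antisymm
  · intro k hk
    by_contra hkl
    refine hk ?_
    rw [component, ← hg, ← mul_assoc]
    simp only [← PiretAlgebra.constHom_apply, ← map_mul, Finset.mul_sum]
    rw [Finset.sum_eq_zero, map_zero, zero_mul]
    intro i _
    rw [← mul_zero (idem hπ k), idem_mul_eq_iff, ← crt_apply, crt_idem, Pi.single_eq_of_ne,
      map_zero]
    rintro rfl
    exact hkl ⟨i, rfl⟩
  · rintro _ ⟨i, rfl⟩ h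
    have h1 := hlead i
    rw [h, PiretAlgebra.coeff_zero, eq_comm, EmbeddingLike.map_eq_zero_iff] at h1
    exact idem_ne_zero hπ _ h1

end Code

theorem IsPrimeFactorization.ne_zero {F : Type*} [Field F] {n r : ℕ} {π : Fin r → F[X]}
    (hπ : IsPrimeFactorization n π) : n ≠ 0 := by
  rintro rfl
  have h := hπ.prod_eq
  rw [pow_zero, sub_self, Finset.prod_eq_zero_iff] at h
  obtain ⟨k, -, hk⟩ := h
  exact (hπ.irreducible k).ne_zero hk

end CyclicConv

end

open CyclicConv in
theorem mainTheorem2 {F : Type*} [Field F] [Finite F] (n : ℕ) (hn : n.Coprime (Nat.card F))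
    {r : ℕ} (π : Fin r → F[X]) (hπ : IsPrimeFactorization n π)
    (σ : CyclicRing F n ≃ₐ[F] CyclicRing F n)
    {t : ℕ} (l : Fin t → Fin r)
    (hl : ∀ i j : Fin t, i ≠ j → ¬ SigmaEquiv hπ σ (l i) (l j))
    (ho : ∀ i : Fin t, 1 < lOrder hπ σ (l i))
    (d : Fin t → ℕ) :
    ∃ C : Submodule F[X] (Fin n → F[X]),
      IsSigmaCyclicCode σ C ∧
      HasParameters C (∑ i, (π (l i)).natDegree) (∑ i, (π (l i)).natDegree * d i) ∧
      HasSupport hπ σ C (Set.range l) := by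
  have hn0 : n ≠ 0 := hπ.ne_zero
  have hmove : ∀ i, σ (idem hπ (l i)) ≠ idem hπ (l i) := fun i h => by
    have h1 : lOrder hπ σ (l i) = 1 := Function.minimalPeriod_eq_one_iff_isFixedPt.2 h
    exact (ho i).ne' h1
  obtain ⟨g, v, hg, hgv, hshape⟩ := PiretAlgebra.exists_generator σ (fun i => idem hπ (l i)) d
    (fun i j hij a b => pow_idem_mul_pow_idem_eq_zero hπ σ (hl i j hij) (hl j i hij.symm) a b)
    (fun i => idem_mul_self hπ (l i))
    -- The dichotomy is the case of exponent 0 on the second idempotent.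
    (fun i a => by simpa using pow_idem_mul_pow_idem hπ σ a 0 (l i) (l i)) hmove
  have hdeg : ∀ i j, d i < j → (component hπ g (l i)).coeff j = 0 := fun i => (hshape i).1
  have hlead : ∀ i, (component hπ g (l i)).coeff (d i) = (σ ^ d i) (idem hπ (l i)) :=
    fun i => (hshape i).2
  let E := toPiretEquiv σ hn0
  let P : Module.End F[X] (PiretAlgebra σ) := LinearMap.mulRight F[X] (v * g)
  have hP : IsCompl (LinearMap.range P) (LinearMap.ker P) :=
    LinearMap.IsIdempotentElem.isCompl (PiretAlgebra.isIdempotentElem_mulRight hg hgv)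
  -- The splitting by the projection x ↦ x v g, transported back to F[z]^n.
  let C := (LinearMap.range P).map E.symm.toLinearMap
  let D := (LinearMap.ker P).map E.symm.toLinearMap
  have hCD : IsCompl C D := hP.map (Submodule.orderIsoMapComap E.symm)
  have hC : C.map E.toLinearMap = LinearMap.range P := by
    rw [← Submodule.map_comp]
    simp
  have himage : toPiret σ '' C = (Ideal.span {g} : Ideal (PiretAlgebra σ)) := by
    have h1 : toPiret σ '' C = (C.map E.toLinearMap : Set (PiretAlgebra σ)) := rfl
    rw [h1, hC]
    ext y
    rw [SetLike.mem_coe, SetLike.mem_coe, Ideal.mem_span_singleton',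
      PiretAlgebra.exists_mul_eq_iff hg hgv]
  have hsupp := supp_eq_range hπ σ l d hg hlead
  refine ⟨C, ⟨⟨D, hCD⟩, _, himage⟩,
    hasParameters_of_generator hπ σ hn0 l hl d hg hgv hdeg hlead hCD hC, g, ?_, hsupp, himage⟩
  apply isReduced_of_not_sigmaEquiv
  rw [hsupp]
  rintro _ ⟨i, rfl⟩ _ ⟨j, rfl⟩ hij
  exact hl i j fun h => hij (congrArg l h)
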